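/- Let $\mathfrak E$ be a complex Hilbert space and let $\Theta:\mathbb D\to\mathcal L(\mathfrak E)$ be a contractive analytic function on the open unit disk, that is, $\Theta$ is analytic and $\|\Theta(z)\|\le 1$ for $|z|<1$; write $\Theta(z)=\sum_{k\ge 0}z^k\Theta_k$. For a Hilbert space $\mathfrak F$ let $H^2(\mathfrak F)$ be the Hilbert space of square summable power series with coefficients in $\mathfrak F$, and $L^2(\mathfrak F)$ the Hilbert space of square summable Laurent series $\sum_{n\in\mathbb Z}\zeta^n f_n$ with coefficients in $\mathfrak F$, so that $H^2(\mathfrak F)\subset L^2(\mathfrak F)$. Let $T_\Theta$ be multiplication by $\Theta$ on $H^2(\mathfrak E)$, let $L_\Theta$ be the Laurent operator, i.e. multiplication by $\sum_k\zeta^k\Theta_k$, on $L^2(\mathfrak E)$, let $D=(I-L_\Theta^*L_\Theta)^{1/2}$, and let $\mathfrak D=(DL^2(\mathfrak E))^-$, which is invariant under multiplication by $\zeta$. (When $\mathfrak E$ is separable and $L^2(\mathfrak E)$ is viewed as a space of functions on the unit circle, $D$ is multiplication by $\Delta(\zeta)=(I-\Theta(\zeta)^*\Theta(\zeta))^{1/2}$,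 where $\Theta(\zeta)$ is the strong radial limit.) The model $\mathbb W(\Theta)=(W_0,W_1)$ is the pair of operators on $$\mathfrak K=H^2(\mathfrak E)\oplus H^2(\mathfrak D)$$ given, for $f\in H^2(\mathfrak E)$ and $g=\sum_{n\ge0}w^ng_n\in H^2(\mathfrak D)$, by $$W_0(f\oplus g)=zf\oplus\sum_{n\ge0}w^n\,(\zeta g_n),\qquad W_1(f\oplus g)=T_\Theta f\oplus\Bigl(Df+\sum_{n\ge0}w^{n+1}g_n\Bigr).$$ A closed subspace $\mathfrak M$ is reducing for a family of operators if both $\mathfrak M$ and $\mathfrak M^\perp$ are invariant for every member of the family. The pair $(W_0,W_1)$ is called $\{1\}$-pure if there is no nonzero reducing subspace $\mathfrak M$ for $(W_0,W_1)$ such that $W_1|\mathfrak M$ is unitary. An operator $T$ is called completely nonunitary if there is no nonzero reducing subspace $\mathfrak M$ for $T$ such that $T|\mathfrak M$ is unitary. Then: (1) $W_1$ is unitary if and only if $\Theta(z)=\Theta(0)$ for all $z\in\mathbb D$ and $\Theta(0)$ is a unitary operator in $\mathcal L(\mathfrak E)$. (2) $\mathbb W(\Theta)$ is $\{1\}$-pure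 if and only if the contraction $\Theta(0)$ is completely nonunitary. -/

import Mathlib

open scoped InnerProductSpace

namespace BiIsometry


section Families

variable {H : Type*} [NormedAddCommGroup H] [InnerProductSpace ℂ H] {I : Type*}

/-- `M` is a (closed) reducing subspace for the family `V`: both `M` and its orthogonal
complement are invariant for every `V i`. -/
structure IsReducing (V : I → H →L[ℂ] H) (M : Submodule ℂ H) : Prop where
  isClosed : IsClosed (M : Set H)
  invariant : ∀ i, ∀ x ∈ M, V i x ∈ M
  invariant_orthogonal : ∀ i, ∀ x ∈ Mᗮ, V i x ∈ Mᗮ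

/-- The restriction `V|M` of a family to a reducing subspace. -/
def IsReducing.restrict {V : I → H →L[ℂ] H} {M : Submodule ℂ H} (hM : IsReducing V M) :
    I → M →L[ℂ] M :=
  fun i => (V i).restrict (hM.invariant i)

/-- The family `V` is `J`-unitary: `V j` is a unitary operator for every `j ∈ J`. -/
def IsUnitaryOn [CompleteSpace H] (J : Set I) (V : I → H →L[ℂ] H) : Prop :=
  ∀ j ∈ J, V j ∈ unitary (H →L[ℂ] H)

/-- The family `V` is `J`-pure: it has no `J`-unitary direct summand on a nonzero space. -/
def IsPure [CompleteSpace H] (J : Set I) (V : I → H →L[ℂ] H) : Prop :=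
  ∀ (M : Submodule ℂ H) (hM : IsReducing V M), M ≠ ⊥ →
    haveI : CompleteSpace M := hM.isClosed.completeSpace_coe
    ¬ IsUnitaryOn J hM.restrict

/-- A single operator is completely nonunitary: it has no unitary direct summand on a nonzero
space. -/
def IsCompletelyNonunitary [CompleteSpace H] (T : H →L[ℂ] H) : Prop :=
  IsPure Set.univ (fun _ : Unit => T)

end Families

section Coefficients

variable {E : Type*} [NormedAddCommGroup E] [InnerProductSpace ℂ E]

/-- A contractive analytic function on the unit disk with values in the bounded operators
on `E`. Values outside the open unit disk are irrelevant. -/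
structure IsContractiveAnalytic (Θ : ℂ → E →L[ℂ] E) : Prop where
  differentiableOn : DifferentiableOn ℂ Θ (Metric.ball 0 1)
  norm_le_one : ∀ z ∈ Metric.ball (0 : ℂ) 1, ‖Θ z‖ ≤ 1

/-- The Taylor coefficients `Θ_k` of `Θ` at the origin, so `Θ(z) = ∑ z ^ k Θ_k`. -/
noncomputable def coeff (Θ : ℂ → E →L[ℂ] E) (k : ℕ) : E →L[ℂ] E :=
  ((k.factorial : ℂ)⁻¹) • iteratedDeriv k Θ 0

theorem sum_root_orthogonal {L : ℕ} {ω : ℂ} (hω : IsPrimitiveRoot ω L) (hL : L ≠ 0) {n m : ℕ}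
    (hn : n < L) (hm : m < L) :
    ∑ j ∈ Finset.range L, (starRingEnd ℂ) (ω ^ (j * n)) * ω ^ (j * m) =
      if n = m then (L : ℂ) else 0 := by
  have hnorm : ‖ω‖ = 1 := hω.norm'_eq_one hL
  have hω0 : ω ≠ 0 := hω.ne_zero hL
  have hc : (starRingEnd ℂ) ω = ω⁻¹ := (Complex.inv_eq_conj hnorm).symm
  have h1 : ∀ j, (starRingEnd ℂ) (ω ^ (j * n)) * ω ^ (j * m) = (ω⁻¹ ^ n * ω ^ m) ^ j := by
    intro j
    rw [map_pow, hc, mul_pow, ← pow_mul, ← pow_mul, mul_comm n j, mul_comm m j]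
  simp only [h1]
  split_ifs with h
  · subst h
    simp [hω0]
  · have hne : ω⁻¹ ^ n * ω ^ m ≠ 1 := by
      intro h2
      apply h
      rw [inv_pow, inv_mul_eq_one₀ (pow_ne_zero _ hω0)] at h2
      exact hω.pow_inj hn hm h2
    have hp : (ω⁻¹ ^ n * ω ^ m) ^ L = 1 := by
      rw [mul_pow, ← pow_mul, ← pow_mul, mul_comm n, mul_comm m, pow_mul, pow_mul, inv_pow,
        hω.pow_eq_one]
      simp
    rw [geom_sum_eq hne, hp]
    simp

theorem discrete_parseval {L : ℕ} {ω : ℂ} (hω : IsPrimitiveRoot ω L) (hL : L ≠ 0) (c : ℕ → E) :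
    ∑ j ∈ Finset.range L, ‖∑ n ∈ Finset.range L, ω ^ (j * n) • c n‖ ^ 2 =
      L * ∑ n ∈ Finset.range L, ‖c n‖ ^ 2 := by
  have key : ∑ j ∈ Finset.range L, ⟪∑ n ∈ Finset.range L, ω ^ (j * n) • c n,
      ∑ n ∈ Finset.range L, ω ^ (j * n) • c n⟫_ℂ =
      L * ∑ n ∈ Finset.range L, ⟪c n, c n⟫_ℂ := by
    simp only [sum_inner, inner_sum, inner_smul_left, inner_smul_right, Finset.mul_sum]
    rw [Finset.sum_comm]
    refine Finset.sum_congr rfl fun n hn => ?_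
    rw [Finset.sum_comm]
    have : ∀ m ∈ Finset.range L, ∑ j ∈ Finset.range L,
        ω ^ (j * n) * ((starRingEnd ℂ) (ω ^ (j * m)) * ⟪c m, c n⟫_ℂ) =
        if m = n then (L : ℂ) * ⟪c n, c n⟫_ℂ else 0 := by
      intro m hm
      rw [Finset.sum_congr rfl fun j _ => show _ = ((starRingEnd ℂ) (ω ^ (j * m)) *
        ω ^ (j * n)) * ⟪c m, c n⟫_ℂ by ring]
      rw [← Finset.sum_mul, sum_root_orthogonal hω hL (Finset.mem_range.1 hm)
        (Finset.mem_range.1 hn)]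
      split_ifs with h
      · rw [h]
      · simp
    rw [Finset.sum_congr rfl this]
    simp [Finset.mem_range.1 hn]
  simp only [inner_self_eq_norm_sq_to_K] at key
  apply Complex.ofReal_injective
  push_cast
  exact key

theorem IsContractiveAnalytic.norm_coeff_le [CompleteSpace E] {Θ : ℂ → E →L[ℂ] E}
    (h : IsContractiveAnalytic Θ) (k : ℕ) : ‖coeff Θ k‖ ≤ 1 := by
  have key : ∀ r ∈ Set.Ioo (0 : ℝ) 1, ‖coeff Θ k‖ * r ^ k ≤ 1 := by
    intro r hr
    have h1 := Complex.norm_iteratedDeriv_le_of_forall_mem_sphere_norm_le (f := Θ) (c := 0) (C := 1)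
      k hr.1 ?_ ?_
    · rw [coeff, norm_smul, norm_inv, Complex.norm_natCast]
      have hk : (0 : ℝ) < k.factorial := by exact_mod_cast k.factorial_pos
      rw [mul_one, le_div_iff₀ (pow_pos hr.1 k)] at h1
      rw [mul_assoc, inv_mul_le_iff₀ hk, mul_one]
      exact h1
    · refine (h.differentiableOn.mono ?_).diffContOnCl
      intro z hz
      have := Metric.closure_ball_subset_closedBall hz
      simp only [Metric.mem_closedBall, dist_zero_right, Metric.mem_ball] at this ⊢
      linarith [hr.2]
    · intro z hz
      apply h.norm_le_one
      simp only [Metric.mem_sphere, dist_zero_right, Metric.mem_ball] at hz ⊢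
      linarith [hr.2]
  have ht : Filter.Tendsto (fun r : ℝ => ‖coeff Θ k‖ * r ^ k) (nhdsWithin 1 (Set.Iio 1))
      (nhds (‖coeff Θ k‖ * 1 ^ k)) := by
    refine Filter.Tendsto.mono_left (Continuous.tendsto (by fun_prop) _) nhdsWithin_le_nhds
  rw [one_pow, mul_one] at ht
  refine le_of_tendsto ht ?_
  filter_upwards [Ioo_mem_nhdsLT (zero_lt_one' ℝ)] with r hr using key r hr

theorem IsContractiveAnalytic.hasSum_coeff [CompleteSpace E] {Θ : ℂ → E →L[ℂ] E}
    (h : IsContractiveAnalytic Θ) {z : ℂ} (hz : ‖z‖ < 1) :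
    HasSum (fun k => z ^ k • coeff Θ k) (Θ z) := by
  have := Complex.hasSum_taylorSeries_on_ball (c := 0) (r := 1) (f := Θ) (z := z)
    (by simpa using h.differentiableOn) (by simpa using hz)
  simp only [sub_zero] at this
  have e : (fun k => z ^ k • coeff Θ k) =
      fun k => ((k.factorial : ℂ)⁻¹) • z ^ k • iteratedDeriv k Θ 0 := by
    funext k
    rw [coeff, smul_comm]
  rw [e]
  exact this

/-- The partial sums of the power series of `Θ` are almost contractive on smaller circles. -/
theorem IsContractiveAnalytic.norm_partial_le [CompleteSpace E] {Θ : ℂ → E →L[ℂ] E}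
    (h : IsContractiveAnalytic Θ) {r : ℝ} (hr : r ∈ Set.Ioo (0 : ℝ) 1) {z : ℂ} (hz : ‖z‖ = r)
    (M : ℕ) : ‖∑ k ∈ Finset.range M, z ^ k • coeff Θ k‖ ≤ 1 + r ^ M / (1 - r) := by
  have hs := h.hasSum_coeff (z := z) (by rw [hz]; exact hr.2)
  have h1 := (hasSum_nat_add_iff' M).2 hs
  have h2 : HasSum (fun k => r ^ M * r ^ k) (r ^ M * (1 - r)⁻¹) :=
    (hasSum_geometric_of_lt_one hr.1.le hr.2).mul_left _
  have h3 : ‖Θ z - ∑ k ∈ Finset.range M, z ^ k • coeff Θ k‖ ≤ r ^ M * (1 - r)⁻¹ := by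
    rw [← h1.tsum_eq]
    refine tsum_of_norm_bounded h2 fun k => ?_
    rw [norm_smul, norm_pow, hz, ← pow_add, add_comm M k]
    exact mul_le_of_le_one_right (pow_nonneg hr.1.le _) (h.norm_coeff_le _)
  have h4 : ‖Θ z‖ ≤ 1 := h.norm_le_one z (by simpa [hz] using hr.2)
  have h5 := norm_sub_norm_le (∑ k ∈ Finset.range M, z ^ k • coeff Θ k) (Θ z)
  rw [norm_sub_rev] at h5
  rw [div_eq_mul_inv]
  linarith

theorem IsContractiveAnalytic.sum_cauchy_le [CompleteSpace E] {Θ : ℂ → E →L[ℂ] E}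
    (h : IsContractiveAnalytic Θ) (x : ℕ → E) (N : ℕ) :
    ∑ n ∈ Finset.range N, ‖∑ k ∈ Finset.range (n + 1), coeff Θ k (x (n - k))‖ ^ 2 ≤
      ∑ n ∈ Finset.range N, ‖x n‖ ^ 2 := by
  rcases Nat.eq_zero_or_pos N with rfl | hN
  · simp
  have step1 : ∀ r ∈ Set.Ioo (0 : ℝ) 1, ∀ M, N ≤ M →
      ∑ n ∈ Finset.range N,
        ‖∑ k ∈ Finset.range (n + 1), ((r : ℂ) ^ k) • coeff Θ k (x (n - k))‖ ^ 2 ≤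
      (1 + r ^ M / (1 - r)) ^ 2 * ∑ n ∈ Finset.range N, ‖x n‖ ^ 2 := by
    intro r hr M hM
    set L := M + N with hLdef
    have hL : L ≠ 0 := by omega
    have hω := Complex.isPrimitiveRoot_exp L hL
    set ω := Complex.exp (2 * Real.pi * Complex.I / L) with hωdef
    have hnorm : ‖ω‖ = 1 := hω.norm'_eq_one hL
    set c : ℕ → E := fun n => ∑ k ∈ Finset.range M, ∑ l ∈ Finset.range N,
      if k + l = n then ((r : ℂ) ^ k) • coeff Θ k (x l) else 0 with hc
    set y : ℕ → E := fun n => if n < N then x n else 0 with hy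
    have hg : ∀ j, ∑ n ∈ Finset.range L, ω ^ (j * n) • c n =
        (∑ k ∈ Finset.range M, ((r : ℂ) * ω ^ j) ^ k • coeff Θ k)
          (∑ n ∈ Finset.range L, ω ^ (j * n) • y n) := by
      intro j
      have hy' : ∑ n ∈ Finset.range L, ω ^ (j * n) • y n =
          ∑ n ∈ Finset.range N, ω ^ (j * n) • x n := by
        symm
        rw [← Finset.sum_subset (Finset.range_mono (by omega : N ≤ L))]
        · refine Finset.sum_congr rfl fun n hn => ?_
          simp [hy, Finset.mem_range.1 hn]
        · intro n _ hn
          simp only [Finset.mem_range] at hn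
          simp [hy, hn]
      rw [hy', sum_apply]
      simp only [hc, Finset.smul_sum, map_sum]
      rw [Finset.sum_comm]
      refine Finset.sum_congr rfl fun k hk => ?_
      rw [Finset.sum_comm]
      refine Finset.sum_congr rfl fun l hl => ?_
      rw [Finset.mem_range] at hk hl
      rw [Finset.sum_eq_single (k + l)]
      · simp only [if_true, smul_apply, map_smul, smul_smul]
        congr 1
        ring
      · intro n _ hn
        rw [if_neg (Ne.symm hn), smul_zero]
      · intro hn
        exact absurd (Finset.mem_range.2 (by omega)) hn
    have hcn : ∀ n ∈ Finset.range N, c n =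
        ∑ k ∈ Finset.range (n + 1), ((r : ℂ) ^ k) • coeff Θ k (x (n - k)) := by
      intro n hn
      rw [Finset.mem_range] at hn
      simp only [hc]
      symm
      rw [← Finset.sum_subset (Finset.range_mono (by omega : n + 1 ≤ M))]
      · refine Finset.sum_congr rfl fun k hk => ?_
        rw [Finset.mem_range] at hk
        rw [Finset.sum_eq_single (n - k)]
        · rw [if_pos (by omega)]
        · intro l _ hl
          rw [if_neg (by omega)]
        · intro hl
          exact absurd (Finset.mem_range.2 (by omega)) hl
      · intro k _ hk
        rw [Finset.mem_range] at hk
        refine Finset.sum_eq_zero fun l _ => ?_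
        rw [if_neg (by omega)]
    have hb : (0 : ℝ) ≤ 1 + r ^ M / (1 - r) := by
      have := pow_nonneg hr.1.le M
      have := div_nonneg this (sub_nonneg.2 hr.2.le)
      linarith
    have hP : ∑ n ∈ Finset.range L, ‖c n‖ ^ 2 ≤
        (1 + r ^ M / (1 - r)) ^ 2 * ∑ n ∈ Finset.range L, ‖y n‖ ^ 2 := by
      have hLpos : (0 : ℝ) < L := by exact_mod_cast Nat.pos_of_ne_zero hL
      refine le_of_mul_le_mul_left ?_ hLpos
      rw [← discrete_parseval hω hL, mul_left_comm, ← discrete_parseval hω hL, Finset.mul_sum]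
      refine Finset.sum_le_sum fun j _ => ?_
      rw [hg, ← mul_pow]
      refine pow_le_pow_left₀ (norm_nonneg _) ?_ 2
      refine (ContinuousLinearMap.le_opNorm _ _).trans ?_
      refine mul_le_mul_of_nonneg_right ?_ (norm_nonneg _)
      refine h.norm_partial_le hr ?_ M
      rw [norm_mul, norm_pow, hnorm, one_pow, mul_one, Complex.norm_real, Real.norm_of_nonneg hr.1.le]
    have hy2 : ∑ n ∈ Finset.range L, ‖y n‖ ^ 2 = ∑ n ∈ Finset.range N, ‖x n‖ ^ 2 := by
      symm
      rw [← Finset.sum_subset (Finset.range_mono (by omega : N ≤ L))]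
      · refine Finset.sum_congr rfl fun n hn => ?_
        simp [hy, Finset.mem_range.1 hn]
      · intro n _ hn
        simp only [Finset.mem_range] at hn
        simp [hy, hn]
    rw [hy2] at hP
    refine le_trans ?_ hP
    rw [Finset.sum_congr rfl fun n hn => by rw [← hcn n hn]]
    exact Finset.sum_le_sum_of_subset_of_nonneg (Finset.range_mono (by omega))
      fun _ _ _ => by positivity
  have step2 : ∀ r ∈ Set.Ioo (0 : ℝ) 1,
      ∑ n ∈ Finset.range N,
        ‖∑ k ∈ Finset.range (n + 1), ((r : ℂ) ^ k) • coeff Θ k (x (n - k))‖ ^ 2 ≤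
      ∑ n ∈ Finset.range N, ‖x n‖ ^ 2 := by
    intro r hr
    have ht : Filter.Tendsto
        (fun M : ℕ => (1 + r ^ M / (1 - r)) ^ 2 * ∑ n ∈ Finset.range N, ‖x n‖ ^ 2)
        Filter.atTop (nhds ((1 + 0 / (1 - r)) ^ 2 * ∑ n ∈ Finset.range N, ‖x n‖ ^ 2)) :=
      (((tendsto_pow_atTop_nhds_zero_of_lt_one hr.1.le hr.2).div_const _).const_add 1
        |>.pow 2).mul_const _
    simp only [zero_div, add_zero, one_pow, one_mul] at ht
    refine ge_of_tendsto ht ?_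
    filter_upwards [Filter.eventually_ge_atTop N] with M hM using step1 r hr M hM
  have ht : Filter.Tendsto (fun r : ℝ => ∑ n ∈ Finset.range N,
        ‖∑ k ∈ Finset.range (n + 1), ((r : ℂ) ^ k) • coeff Θ k (x (n - k))‖ ^ 2)
      (nhdsWithin 1 (Set.Iio 1)) (nhds (∑ n ∈ Finset.range N,
        ‖∑ k ∈ Finset.range (n + 1), (((1 : ℝ) : ℂ) ^ k) • coeff Θ k (x (n - k))‖ ^ 2)) := by
    refine Filter.Tendsto.mono_left (Continuous.tendsto (by fun_prop) _) nhdsWithin_le_nhds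
  simp only [Complex.ofReal_one, one_pow, one_smul] at ht
  refine le_of_tendsto ht ?_
  filter_upwards [Ioo_mem_nhdsLT (zero_lt_one' ℝ)] with r hr using step2 r hr

/-- Any finitely many of the series `∑ Θ_k y_k` are controlled by the `ℓ²` norm of `y`. -/
theorem IsContractiveAnalytic.norm_sum_sq_le [CompleteSpace E] {Θ : ℂ → E →L[ℂ] E}
    (h : IsContractiveAnalytic Θ) (y : ℕ → E) (s : Finset ℕ) :
    ‖∑ k ∈ s, coeff Θ k (y k)‖ ^ 2 ≤ ∑ k ∈ s, ‖y k‖ ^ 2 := by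
  set n := s.sup id with hn
  have hs : s ⊆ Finset.range (n + 1) := fun k hk =>
    Finset.mem_range.2 (Nat.lt_succ_of_le (Finset.le_sup (f := id) hk))
  have h1 := h.sum_cauchy_le (fun l => if n - l ∈ s then y (n - l) else 0) (n + 1)
  have h2 := (Finset.single_le_sum (f := fun m => ‖∑ k ∈ Finset.range (m + 1),
    coeff Θ k (if n - (m - k) ∈ s then y (n - (m - k)) else 0)‖ ^ 2)
    (fun _ _ => by positivity) (Finset.self_mem_range_succ n)).trans h1
  have h3 : ∑ k ∈ Finset.range (n + 1),
      coeff Θ k (if n - (n - k) ∈ s then y (n - (n - k)) else 0) = ∑ k ∈ s, coeff Θ k (y k) := by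
    symm
    rw [← Finset.sum_subset hs]
    · refine Finset.sum_congr rfl fun k hk => ?_
      have : n - (n - k) = k := by have := Finset.mem_range.1 (hs hk); omega
      rw [this, if_pos hk]
    · intro k hk hks
      have : n - (n - k) = k := by have := Finset.mem_range.1 hk; omega
      rw [this, if_neg hks, map_zero]
  have h4 : ∑ l ∈ Finset.range (n + 1), ‖if n - l ∈ s then y (n - l) else 0‖ ^ 2 =
      ∑ k ∈ s, ‖y k‖ ^ 2 := by
    have := Finset.sum_range_reflect (fun k => ‖if k ∈ s then y k else 0‖ ^ 2) (n + 1)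
    simp only [Nat.add_sub_cancel] at this
    rw [this]
    symm
    rw [← Finset.sum_subset hs]
    · exact Finset.sum_congr rfl fun k hk => by rw [if_pos hk]
    · intro k _ hks
      simp [hks]
  rw [h3, h4] at h2
  exact h2

theorem IsContractiveAnalytic.summable_coeff [CompleteSpace E] {Θ : ℂ → E →L[ℂ] E}
    (h : IsContractiveAnalytic Θ) {y : ℕ → E} (hy : Summable fun k => ‖y k‖ ^ 2) :
    Summable fun k => coeff Θ k (y k) := by
  rw [summable_iff_vanishing_norm] at hy ⊢
  intro ε hε
  obtain ⟨s, hs⟩ := hy (ε ^ 2) (by positivity)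
  refine ⟨s, fun t ht => ?_⟩
  have h1 := hs t ht
  rw [Real.norm_of_nonneg (Finset.sum_nonneg fun _ _ => by positivity)] at h1
  exact lt_of_pow_lt_pow_left₀ 2 hε.le ((h.norm_sum_sq_le y t).trans_lt h1)

end Coefficients

section SequenceSpaces

variable {E F X ι κ : Type*} [NormedAddCommGroup E] [InnerProductSpace ℂ E]
  [NormedAddCommGroup F] [InnerProductSpace ℂ F] [NormedAddCommGroup X] [NormedSpace ℂ X]

/-- The Hardy space `H²(E)`: square summable power series `∑ z ^ n f n`, `n ≥ 0`, with
coefficients in `E`. -/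
abbrev HardySpace (E : Type*) [NormedAddCommGroup E] : Type _ := lp (fun _ : ℕ => E) 2

/-- The space `L²(E)`: square summable Laurent series `∑ ζ ^ n f n`, `n ∈ ℤ`, with coefficients
in `E` (equivalently, square integrable `E`-valued functions on the unit circle, through their
Fourier coefficients). -/
abbrev LaurentSpace (E : Type*) [NormedAddCommGroup E] : Type _ := lp (fun _ : ℤ => E) 2

theorem sum_norm_sq_le (f : lp (fun _ : ι => E) 2) (s : Finset ι) :
    ∑ i ∈ s, ‖f i‖ ^ 2 ≤ ‖f‖ ^ 2 := by
  have := lp.sum_rpow_le_norm_rpow (p := 2) (by norm_num) f s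
  simpa using this

theorem summable_norm_sq (f : lp (fun _ : ι => E) 2) : Summable fun i => ‖f i‖ ^ 2 :=
  summable_of_sum_le (fun _ => by positivity) (sum_norm_sq_le f)

theorem sum_norm_sq_comp_le (f : lp (fun _ : ι => E) 2) {g : κ → ι} (hg : g.Injective)
    (s : Finset κ) : ∑ i ∈ s, ‖f (g i)‖ ^ 2 ≤ ‖f‖ ^ 2 := by
  have := sum_norm_sq_le f (s.map ⟨g, hg⟩)
  simpa using this

/-- The contraction into `ℓ²(ι, F)` with given coordinates. -/
noncomputable def ofCoords (A : X →ₗ[ℂ] (ι → F))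
    (hA : ∀ x (s : Finset ι), ∑ i ∈ s, ‖A x i‖ ^ 2 ≤ ‖x‖ ^ 2) :
    X →L[ℂ] lp (fun _ : ι => F) 2 :=
  LinearMap.mkContinuous
    { toFun := fun x => ⟨A x, memℓp_gen' (C := ‖x‖ ^ 2) fun s => by simpa using hA x s⟩
      map_add' := fun x y => by ext i; exact congrFun (map_add A x y) i
      map_smul' := fun c x => by ext i; exact congrFun (map_smul A c x) i } 1
    (fun x => by
      rw [one_mul]
      exact lp.norm_le_of_forall_sum_le (by norm_num) (norm_nonneg _)
        fun s => by simpa using hA x s)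

@[simp] theorem ofCoords_apply (A : X →ₗ[ℂ] (ι → F))
    (hA : ∀ x (s : Finset ι), ∑ i ∈ s, ‖A x i‖ ^ 2 ≤ ‖x‖ ^ 2) (x : X) (i : ι) :
    ofCoords A hA x i = A x i := rfl

theorem norm_ofCoords_apply_le (A : X →ₗ[ℂ] (ι → F))
    (hA : ∀ x (s : Finset ι), ∑ i ∈ s, ‖A x i‖ ^ 2 ≤ ‖x‖ ^ 2) (x : X) :
    ‖ofCoords A hA x‖ ≤ ‖x‖ :=
  lp.norm_le_of_forall_sum_le (by norm_num) (norm_nonneg _) fun s => by simpa using hA x s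

/-- The unilateral shift `S_E` on `H²(E)`: multiplication by `z`, so `(S f)_0 = 0` and
`(S f)_(n+1) = f_n`. -/
noncomputable def unilateralShift (E : Type*) [NormedAddCommGroup E] [InnerProductSpace ℂ E] :
    HardySpace E →L[ℂ] HardySpace E :=
  ofCoords
    { toFun := fun f n => Nat.casesOn n 0 fun m => f m
      map_add' := fun f g => by ext n; cases n <;> simp
      map_smul' := fun c f => by ext n; cases n <;> simp }
    (fun f s => by
      refine le_trans ?_ (sum_norm_sq_le f (s.image Nat.pred))
      rw [← Finset.sum_filter_add_sum_filter_not s (· = 0)]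
      rw [Finset.sum_eq_zero fun n hn => by rw [(Finset.mem_filter.1 hn).2]; simp, zero_add]
      rw [Finset.sum_congr rfl fun n hn => show _ = ‖f n.pred‖ ^ 2 by
        cases n with
        | zero => exact absurd rfl (Finset.mem_filter.1 hn).2
        | succ m => rfl]
      rw [← Finset.sum_image (f := fun m => ‖f m‖ ^ 2) (g := Nat.pred)]
      · exact Finset.sum_le_sum_of_subset_of_nonneg
          (Finset.image_subset_image (Finset.filter_subset _ _)) fun _ _ _ => by positivity
      · intro a ha b hb hab
        have ha' := (Finset.mem_filter.1 (Finset.mem_coe.1 ha)).2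
        have hb' := (Finset.mem_filter.1 (Finset.mem_coe.1 hb)).2
        simp only [Nat.pred_eq_sub_one] at hab
        omega)

/-- Multiplication by `ζ ^ m` on `L²(E)`. -/
noncomputable def translate (E : Type*) [NormedAddCommGroup E] [InnerProductSpace ℂ E] (m : ℤ) :
    LaurentSpace E →L[ℂ] LaurentSpace E :=
  ofCoords
    { toFun := fun f n => f (n - m)
      map_add' := fun f g => by ext n; simp
      map_smul' := fun c f => by ext n; simp }
    (fun f s => sum_norm_sq_comp_le f (sub_left_injective (b := m)) s)

/-- The bilateral shift `U_E` on `L²(E)`: multiplication by `ζ`. -/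
noncomputable def bilateralShift (E : Type*) [NormedAddCommGroup E] [InnerProductSpace ℂ E] :
    LaurentSpace E →L[ℂ] LaurentSpace E :=
  translate E 1

/-- The inclusion `H²(E) ⊆ L²(E)`. -/
noncomputable def hardyInclusion (E : Type*) [NormedAddCommGroup E] [InnerProductSpace ℂ E] :
    HardySpace E →L[ℂ] LaurentSpace E :=
  ofCoords
    { toFun := fun f n => if 0 ≤ n then f n.toNat else 0
      map_add' := fun f g => by ext n; by_cases hn : 0 ≤ n <;> simp [hn]
      map_smul' := fun c f => by ext n; by_cases hn : 0 ≤ n <;> simp [hn] }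
    (fun f s => by
      refine le_trans ?_ (sum_norm_sq_le f (s.image Int.toNat))
      rw [← Finset.sum_filter_add_sum_filter_not s (0 ≤ ·)]
      rw [Finset.sum_eq_zero (s := s.filter fun n => ¬ 0 ≤ n) fun n hn => by
        simp only [LinearMap.coe_mk, AddHom.coe_mk]
        rw [if_neg (Finset.mem_filter.1 hn).2]; simp, add_zero]
      rw [Finset.sum_congr rfl fun n hn => show _ = ‖f n.toNat‖ ^ 2 by
        simp only [LinearMap.coe_mk, AddHom.coe_mk]
        rw [if_pos (Finset.mem_filter.1 hn).2]]
      rw [← Finset.sum_image (f := fun m => ‖f m‖ ^ 2) (g := Int.toNat)]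
      · exact Finset.sum_le_sum_of_subset_of_nonneg
          (Finset.image_subset_image (Finset.filter_subset _ _)) fun _ _ _ => by positivity
      · intro a ha b hb hab
        have ha' := (Finset.mem_filter.1 (Finset.mem_coe.1 ha)).2
        have hb' := (Finset.mem_filter.1 (Finset.mem_coe.1 hb)).2
        omega)

/-- The contraction `T` on `F` applied to every coefficient of a power series in `H²(F)`. -/
noncomputable def coefficientwise (T : F →L[ℂ] F) (hT : ∀ x, ‖T x‖ ≤ ‖x‖) :
    HardySpace F →L[ℂ] HardySpace F :=
  ofCoords
    { toFun := fun f n => T (f n)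
      map_add' := fun f g => by ext n; simp
      map_smul' := fun c f => by ext n; simp }
    (fun f s => le_trans (Finset.sum_le_sum fun n _ =>
      pow_le_pow_left₀ (norm_nonneg _) (hT (f n)) 2) (sum_norm_sq_le f s))

end SequenceSpaces

section SquareRoot

variable {H : Type*} [NormedAddCommGroup H] [InnerProductSpace ℂ H] [CompleteSpace H]

/-- The nonnegative square root `(I - A* A)^(1/2)` for a contraction `A`. -/
noncomputable def defectOperator (A : H →L[ℂ] H) : H →L[ℂ] H :=
  CFC.sqrt (1 - ContinuousLinearMap.adjoint A * A)

/-- For a contraction `A` the operator under the square root is nonnegative, so that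
`defectOperator A` is its nonnegative square root. -/
theorem defectOperator_mul_self {A : H →L[ℂ] H} (hA : ∀ x, ‖A x‖ ≤ ‖x‖) :
    defectOperator A * defectOperator A = 1 - ContinuousLinearMap.adjoint A * A := by
  refine CFC.sqrt_mul_sqrt_self _ ?_
  rw [ContinuousLinearMap.nonneg_iff_isPositive, ContinuousLinearMap.isPositive_iff_complex]
  intro x
  have h : ⟪(1 - ContinuousLinearMap.adjoint A * A) x, x⟫_ℂ =
      ((‖x‖ ^ 2 - ‖A x‖ ^ 2 : ℝ) : ℂ) := by
    rw [sub_apply, inner_sub_left, ContinuousLinearMap.mul_def,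
      ContinuousLinearMap.comp_apply, ContinuousLinearMap.adjoint_inner_left,
      one_apply_eq_self, inner_self_eq_norm_sq_to_K, inner_self_eq_norm_sq_to_K]
    push_cast
    rfl
  rw [h]
  refine ⟨rfl, ?_⟩
  exact sub_nonneg.2 (pow_le_pow_left₀ (norm_nonneg _) (hA x) 2)

theorem defectOperator_commute {A B : H →L[ℂ] H}
    (h : Commute (1 - ContinuousLinearMap.adjoint A * A) B) : Commute (defectOperator A) B :=
  h.cfcₙ_nnreal _

end SquareRoot

section Model

variable {E : Type*} [NormedAddCommGroup E] [InnerProductSpace ℂ E] [CompleteSpace E]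
  {Θ : ℂ → E →L[ℂ] E}

/-- The analytic Toeplitz operator `T_Θ` on `H²(E)`: multiplication of power series by
`Θ(z) = ∑ z ^ k Θ_k`. -/
noncomputable def toeplitz (hΘ : IsContractiveAnalytic Θ) : HardySpace E →L[ℂ] HardySpace E :=
  ofCoords
    { toFun := fun f n => ∑ k ∈ Finset.range (n + 1), coeff Θ k (f (n - k))
      map_add' := fun f g => by ext n; simp [Finset.sum_add_distrib]
      map_smul' := fun c f => by ext n; simp [Finset.smul_sum] }
    (fun f s => by
      obtain ⟨N, hN⟩ := s.exists_nat_subset_range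
      exact (Finset.sum_le_sum_of_subset_of_nonneg hN fun _ _ _ => by positivity).trans
        ((hΘ.sum_cauchy_le (fun n => f n) N).trans (sum_norm_sq_le f _)))

theorem IsContractiveAnalytic.summable_laurent (hΘ : IsContractiveAnalytic Θ)
    (f : LaurentSpace E) (n : ℤ) : Summable fun k : ℕ => coeff Θ k (f (n - k)) :=
  hΘ.summable_coeff <| (summable_norm_sq f).comp_injective (i := fun k : ℕ => n - (k : ℤ))
    fun a b hab => by simpa using hab

/-- The Laurent operator `L_Θ` on `L²(E)`: multiplication of Laurent series by
`Θ(ζ) = ∑ ζ ^ k Θ_k`. -/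
noncomputable def laurent (hΘ : IsContractiveAnalytic Θ) : LaurentSpace E →L[ℂ] LaurentSpace E :=
  ofCoords
    { toFun := fun f n => ∑' k : ℕ, coeff Θ k (f (n - k))
      map_add' := fun f g => by
        ext n
        simp only [lp.coeFn_add, Pi.add_apply, map_add]
        exact (hΘ.summable_laurent f n).tsum_add (hΘ.summable_laurent g n)
      map_smul' := fun c f => by
        ext n
        simp only [lp.coeFn_smul, Pi.smul_apply, map_smul, RingHom.id_apply]
        exact (hΘ.summable_laurent f n).tsum_const_smul c }
    (fun f s => by
      have ht : Filter.Tendsto (fun K : ℕ => ∑ n ∈ s,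
          ‖∑ k ∈ Finset.range ((n + K).toNat + 1), coeff Θ k (f (n - k))‖ ^ 2) Filter.atTop
          (nhds (∑ n ∈ s, ‖∑' k : ℕ, coeff Θ k (f (n - k))‖ ^ 2)) := by
        refine tendsto_finsetSum _ fun n _ => ?_
        refine ((Filter.Tendsto.comp (hΘ.summable_laurent f n).hasSum.tendsto_sum_nat ?_).norm).pow 2
        refine Filter.tendsto_atTop.2 fun b => ?_
        filter_upwards [Filter.eventually_ge_atTop (b + n.natAbs)] with K hK
        omega
      refine le_of_tendsto ht ?_
      filter_upwards [Filter.eventually_ge_atTop (s.sup Int.natAbs)] with K hK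
      have hpos : ∀ n ∈ s, 0 ≤ n + K := fun n hn => by
        have : n.natAbs ≤ K := (Finset.le_sup (f := Int.natAbs) hn).trans hK
        omega
      obtain ⟨N, hN⟩ := (s.image fun n : ℤ => (n + K).toNat).exists_nat_subset_range
      have h1 := hΘ.sum_cauchy_le (fun l => f ((l : ℤ) - K)) N
      refine le_trans ?_ (h1.trans (sum_norm_sq_comp_le f (g := fun l : ℕ => (l : ℤ) - K)
        (fun a b hab => by simpa using hab) _))
      refine le_trans ?_ (Finset.sum_le_sum_of_subset_of_nonneg hN fun _ _ _ => by positivity)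
      rw [Finset.sum_image]
      · refine le_of_eq (Finset.sum_congr rfl fun n hn => ?_)
        have hn' := hpos n hn
        congr 2
        refine Finset.sum_congr rfl fun k hk => ?_
        rw [Finset.mem_range] at hk
        have hidx : n - (k : ℤ) = (((n + K).toNat - k : ℕ) : ℤ) - K := by omega
        rw [hidx]
      · intro a ha b hb hab
        have ha' := hpos a ha
        have hb' := hpos b hb
        simp only at hab
        omega)

theorem translate_comp_translate (m m' : ℤ) :
    translate E m ∘L translate E m' = translate E (m + m') := by
  ext f n
  simp only [translate, ContinuousLinearMap.comp_apply, ofCoords_apply, LinearMap.coe_mk,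
    AddHom.coe_mk]
  rw [sub_sub]

theorem translate_zero : translate E 0 = 1 := by
  ext f n
  simp [translate]

theorem norm_translate_apply_le (m : ℤ) (f : LaurentSpace E) : ‖translate E m f‖ ≤ ‖f‖ :=
  norm_ofCoords_apply_le _ _ _

theorem adjoint_translate (m : ℤ) :
    ContinuousLinearMap.adjoint (translate E m) = translate E (-m) := by
  have h1 : ContinuousLinearMap.adjoint (translate E m) ∘L translate E m = 1 := by
    rw [← ContinuousLinearMap.norm_map_iff_adjoint_comp_self]
    intro f
    refine le_antisymm (norm_translate_apply_le m f) ?_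
    have := norm_translate_apply_le (-m) (translate E m f)
    rwa [← ContinuousLinearMap.comp_apply, translate_comp_translate, neg_add_cancel,
      translate_zero, one_apply_eq_self] at this
  calc ContinuousLinearMap.adjoint (translate E m)
      = ContinuousLinearMap.adjoint (translate E m) ∘L (translate E m ∘L translate E (-m)) := by
        rw [translate_comp_translate, add_neg_cancel, translate_zero]; rfl
    _ = translate E (-m) := by
        rw [← ContinuousLinearMap.comp_assoc, h1]; rfl

theorem laurent_commute_translate (hΘ : IsContractiveAnalytic Θ) (m : ℤ) :
    Commute (laurent hΘ) (translate E m) := by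
  ext f n
  simp only [laurent, translate, ContinuousLinearMap.mul_def, ContinuousLinearMap.comp_apply,
    ofCoords_apply, LinearMap.coe_mk, AddHom.coe_mk]
  refine tsum_congr fun k => ?_
  rw [show n - (k : ℤ) - m = n - m - k by ring]

/-- `L_Θ` is the extension of `T_Θ` to `L²(E)`. -/
theorem laurent_hardyInclusion (hΘ : IsContractiveAnalytic Θ) (f : HardySpace E) :
    laurent hΘ (hardyInclusion E f) = hardyInclusion E (toeplitz hΘ f) := by
  ext n
  simp only [laurent, hardyInclusion, toeplitz, ofCoords_apply, LinearMap.coe_mk, AddHom.coe_mk]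
  split_ifs with hn
  · rw [tsum_eq_sum (s := Finset.range (n.toNat + 1))]
    · refine Finset.sum_congr rfl fun k hk => ?_
      rw [Finset.mem_range] at hk
      have h1 : (0 : ℤ) ≤ n - k := by omega
      have h2 : (n - (k : ℤ)).toNat = n.toNat - k := by omega
      rw [if_pos h1, h2]
    · intro k hk
      rw [Finset.mem_range] at hk
      have h1 : ¬ (0 : ℤ) ≤ n - k := by omega
      rw [if_neg h1, map_zero]
  · have h0 : ∀ k : ℕ, coeff Θ k
        (if (0 : ℤ) ≤ n - k then f (n - (k : ℤ)).toNat else 0) = 0 := fun k => by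
      have h1 : ¬ (0 : ℤ) ≤ n - k := by omega
      rw [if_neg h1, map_zero]
    rw [tsum_congr h0]
    exact tsum_zero

/-- The defect operator `D = (I - L_Θ* L_Θ)^(1/2)` on `L²(E)`, that is, multiplication by
`Δ(ζ) = (I - Θ(ζ)* Θ(ζ))^(1/2)`. -/
noncomputable def defect (hΘ : IsContractiveAnalytic Θ) : LaurentSpace E →L[ℂ] LaurentSpace E :=
  defectOperator (laurent hΘ)

theorem defect_mul_self (hΘ : IsContractiveAnalytic Θ) :
    defect hΘ * defect hΘ = 1 - ContinuousLinearMap.adjoint (laurent hΘ) * laurent hΘ :=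
  defectOperator_mul_self fun f => norm_ofCoords_apply_le _ _ f

theorem defect_commute_translate (hΘ : IsContractiveAnalytic Θ) (m : ℤ) :
    Commute (defect hΘ) (translate E m) := by
  have h1 : Commute (ContinuousLinearMap.adjoint (laurent hΘ)) (translate E m) := by
    have h2 := congrArg ContinuousLinearMap.adjoint (laurent_commute_translate hΘ (-m)).eq
    rw [ContinuousLinearMap.mul_def, ContinuousLinearMap.mul_def,
      ContinuousLinearMap.adjoint_comp, ContinuousLinearMap.adjoint_comp, adjoint_translate,
      neg_neg] at h2
    exact h2.symm
  exact defectOperator_commute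
    ((Commute.one_left _).sub_left (h1.mul_left (laurent_commute_translate hΘ m)))

/-- The defect space: the closure of `D L²(E)`. -/
noncomputable def defectSpace (hΘ : IsContractiveAnalytic Θ) : Submodule ℂ (LaurentSpace E) :=
  (LinearMap.range (defect hΘ : LaurentSpace E →ₗ[ℂ] LaurentSpace E)).topologicalClosure

instance (hΘ : IsContractiveAnalytic Θ) : CompleteSpace (defectSpace hΘ) :=
  (Submodule.isClosed_topologicalClosure _).completeSpace_coe

theorem defect_mem (hΘ : IsContractiveAnalytic Θ) (f : LaurentSpace E) :
    defect hΘ f ∈ defectSpace hΘ :=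
  Submodule.le_topologicalClosure _ ⟨f, rfl⟩

/-- The defect space is invariant for `U_E`. -/
theorem bilateralShift_mem (hΘ : IsContractiveAnalytic Θ) {f : LaurentSpace E}
    (hf : f ∈ defectSpace hΘ) : bilateralShift E f ∈ defectSpace hΘ := by
  refine map_mem_closure (bilateralShift E).continuous hf ?_
  rintro _ ⟨g, rfl⟩
  exact ⟨bilateralShift E g, congrArg (fun T => T g) (defect_commute_translate hΘ 1).eq⟩

/-- The restriction of `U_E` to the defect space. -/
noncomputable def defectShift (hΘ : IsContractiveAnalytic Θ) :
    defectSpace hΘ →L[ℂ] defectSpace hΘ :=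
  (bilateralShift E).restrict fun _ hf => bilateralShift_mem hΘ hf

/-- The model space `K = H²(E) ⊕ H²((D L²(E))⁻)`, an orthogonal sum of Hilbert spaces. An element
is written `f ⊕ g`; here `g = ∑ w ^ n g n` is a power series in `w` whose coefficients
`g n ∈ L²(E)` are functions of `ζ`. -/
abbrev ModelSpace (hΘ : IsContractiveAnalytic Θ) : Type _ :=
  WithLp 2 (HardySpace E × HardySpace (defectSpace hΘ))

/-- `W₀(f ⊕ g) = a ⊕ b` with `a(z) = z f(z)` and `b(w, ζ) = ζ g(w, ζ)`. -/
noncomputable def modelW₀ (hΘ : IsContractiveAnalytic Θ) : ModelSpace hΘ →L[ℂ] ModelSpace hΘ :=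
  let e := WithLp.prodContinuousLinearEquiv 2 ℂ (HardySpace E) (HardySpace (defectSpace hΘ))
  e.symm ∘L
    ((unilateralShift E).prodMap (coefficientwise (defectShift hΘ)
      fun g => norm_translate_apply_le 1 (g : LaurentSpace E))) ∘L e

/-- `W₁(f ⊕ g) = c ⊕ d` with `c(z) = Θ(z) f(z)` and `d(w, ζ) = Δ(ζ) f(ζ) + w g(w, ζ)`. -/
noncomputable def modelW₁ (hΘ : IsContractiveAnalytic Θ) : ModelSpace hΘ →L[ℂ] ModelSpace hΘ :=
  let e := WithLp.prodContinuousLinearEquiv 2 ℂ (HardySpace E) (HardySpace (defectSpace hΘ))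
  let Δ : HardySpace E →L[ℂ] defectSpace hΘ :=
    (defect hΘ ∘L hardyInclusion E).codRestrict _ fun f => defect_mem hΘ (hardyInclusion E f)
  e.symm ∘L
    ((toeplitz hΘ ∘L ContinuousLinearMap.fst ℂ _ _).prod
      (lp.singleContinuousLinearMap ℂ (fun _ : ℕ => defectSpace hΘ) 2 0 ∘L Δ ∘L
          ContinuousLinearMap.fst ℂ _ _ +
        unilateralShift (defectSpace hΘ) ∘L ContinuousLinearMap.snd ℂ _ _)) ∘L e

/-- The functional model `W(Θ) = (W₀, W₁)`. -/
noncomputable def model (hΘ : IsContractiveAnalytic Θ) :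
    Fin 2 → ModelSpace hΘ →L[ℂ] ModelSpace hΘ :=
  ![modelW₀ hΘ, modelW₁ hΘ]

end Model

end BiIsometry

/-!
A vector `x` with `‖Θ(0) x‖ = ‖x‖` satisfies `Θ_k x = 0` for `k ≥ 1`, because multiplication by
`Θ` is contractive. So if `Θ(0)` acts unitarily on a closed subspace `N`, then on `H²(N) ⊕ 0` the
defect term vanishes and `W₁` is `Θ(0)` applied to each coefficient; this subspace reduces the
model and `W₁` is unitary on it.

Conversely, let `W₁` act unitarily on a reducing subspace `M`. There the commuting operators `W₀`
and `W₁` doubly commute, so `W₁` commutes with `W₀*` and with the projection `1 - W₀ W₀*` onto the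
constants. Hence it acts on first components as `Θ(0)` coefficientwise, and `Θ(0)` acts unitarily
on the space `N` of constants in `M`. The defect term therefore vanishes on `M`, so
`W₁ (f ⊕ g) = Θ(0) f ⊕ w g`, and surjectivity on `M` forces `g = 0`, that is, `M ⊆ H²(N) ⊕ 0`.
-/

namespace BiIsometry

open scoped InnerProduct

section Operators

variable {H : Type*} [NormedAddCommGroup H] [InnerProductSpace ℂ H]

/-- The operator `T` maps the subspace `M` isometrically onto itself, that is, `M` is invariant
for `T` and `T|M` is unitary. No invariance of `Mᗮ` is required; for a contraction `T` it is
automatic. -/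
structure ActsUnitarilyOn (T : H →L[ℂ] H) (M : Submodule ℂ H) : Prop where
  mapsTo : Set.MapsTo T M M
  surjOn : Set.SurjOn T M M
  norm_map : ∀ x ∈ M, ‖T x‖ = ‖x‖

variable {T V W : H →L[ℂ] H} {M : Submodule ℂ H}

theorem mem_unitary_iff_actsUnitarilyOn_top [CompleteSpace H] :
    T ∈ unitary (H →L[ℂ] H) ↔ ActsUnitarilyOn T ⊤ := by
  constructor
  · intro hT
    refine ⟨fun _ _ => trivial, fun y _ => ⟨(T†) y, trivial, ?_⟩,
      fun x _ => ContinuousLinearMap.norm_map_of_mem_unitary hT x⟩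
    exact congrArg (· y) (Unitary.mul_star_self_of_mem hT)
  · intro hT
    have hiso : T† ∘L T = 1 :=
      (ContinuousLinearMap.norm_map_iff_adjoint_comp_self T).1 fun x => hT.norm_map x trivial
    refine Unitary.mem_iff.2 ⟨hiso, ContinuousLinearMap.ext fun y => ?_⟩
    obtain ⟨x, -, rfl⟩ := hT.surjOn (a := y) trivial
    exact congrArg (fun S => T (S x)) hiso

theorem restrict_mem_unitary_iff [CompleteSpace M] (hM : ∀ x ∈ M, T x ∈ M) :
    T.restrict hM ∈ unitary (M →L[ℂ] M) ↔ ActsUnitarilyOn T M := by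
  rw [mem_unitary_iff_actsUnitarilyOn_top]
  constructor
  · intro h
    refine ⟨hM, fun y hy => ?_, fun x hx => h.norm_map ⟨x, hx⟩ trivial⟩
    obtain ⟨x, -, hxy⟩ := h.surjOn (a := ⟨y, hy⟩) trivial
    exact ⟨x, x.2, congrArg Subtype.val hxy⟩
  · intro h
    refine ⟨fun _ _ => trivial, fun y _ => ?_, fun x _ => h.norm_map x x.2⟩
    obtain ⟨x, hx, hxy⟩ := h.surjOn y.2
    exact ⟨⟨x, hx⟩, trivial, Subtype.ext hxy⟩

variable [CompleteSpace H]

theorem norm_adjoint_apply_le (hT : ‖T‖ ≤ 1) (x : H) : ‖(T†) x‖ ≤ ‖x‖ :=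
  (T†).le_of_opNorm_le ((LinearIsometryEquiv.norm_map _ T).trans_le hT) x |>.trans_eq (one_mul _)

theorem adjoint_apply_apply_of_norm_eq (hT : ‖T‖ ≤ 1) {x : H} (hx : ‖T x‖ = ‖x‖) :
    (T†) (T x) = x := by
  have hle : ‖(T†) (T x)‖ ^ 2 ≤ ‖x‖ ^ 2 := by
    have := norm_adjoint_apply_le hT (T x)
    gcongr
    rwa [hx] at this
  have hexpand := norm_sub_sq (𝕜 := ℂ) ((T†) (T x)) x
  rw [ContinuousLinearMap.adjoint_inner_left, inner_self_eq_norm_sq, hx] at hexpand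
  have hzero : ‖(T†) (T x) - x‖ ^ 2 = 0 := le_antisymm (by linarith) (sq_nonneg _)
  exact sub_eq_zero.1 (norm_eq_zero.1 (pow_eq_zero_iff two_ne_zero |>.1 hzero))

namespace ActsUnitarilyOn

theorem adjoint_mem (hT : ‖T‖ ≤ 1) (h : ActsUnitarilyOn T M) {y : H} (hy : y ∈ M) :
    (T†) y ∈ M := by
  obtain ⟨x, hx, rfl⟩ := h.surjOn hy
  rwa [adjoint_apply_apply_of_norm_eq hT (h.norm_map x hx)]

theorem apply_adjoint_apply (hT : ‖T‖ ≤ 1) (h : ActsUnitarilyOn T M) {y : H} (hy : y ∈ M) :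
    T ((T†) y) = y := by
  obtain ⟨x, hx, rfl⟩ := h.surjOn hy
  rw [adjoint_apply_apply_of_norm_eq hT (h.norm_map x hx)]

theorem adjoint_apply_apply_comm (hW : ‖W‖ ≤ 1) (h : ActsUnitarilyOn W M) (hVW : Commute V W)
    (hV : ∀ x ∈ M, (V†) x ∈ M) {x : H} (hx : x ∈ M) : (V†) (W x) = W ((V†) x) := by
  have hcomm : Commute (W†) (V†) := hVW.symm.star_star
  calc (V†) (W x) = W ((W†) ((V†) (W x))) :=
        (h.apply_adjoint_apply hW (hV _ (h.mapsTo hx))).symm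
    _ = W ((V†) ((W†) (W x))) := congrArg (fun S => W (S (W x))) hcomm.eq
    _ = W ((V†) x) := by rw [adjoint_apply_apply_of_norm_eq hW (h.norm_map x hx)]

end ActsUnitarilyOn

theorem norm_defectOperator_sq {A : H →L[ℂ] H} (hA : ∀ x, ‖A x‖ ≤ ‖x‖) (x : H) :
    ‖defectOperator A x‖ ^ 2 = ‖x‖ ^ 2 - ‖A x‖ ^ 2 := by
  have hself : (defectOperator A)† = defectOperator A := by
    have hnonneg : 0 ≤ defectOperator A := by
      rw [defectOperator]
      exact CFC.sqrt_nonneg _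
    exact ((ContinuousLinearMap.nonneg_iff_isPositive _).1 hnonneg).isSelfAdjoint
  have hsq : defectOperator A (defectOperator A x) = x - (A†) (A x) :=
    congrArg (fun S => S x) (defectOperator_mul_self hA)
  have hre (y : H) : ‖y‖ ^ 2 = RCLike.re ⟪y, y⟫_ℂ := (inner_self_eq_norm_sq y).symm
  rw [hre, hre, hre, ← ContinuousLinearMap.adjoint_inner_right, hself, hsq, inner_sub_right,
    ContinuousLinearMap.adjoint_inner_right, map_sub]

end Operators

section Families

variable {H I : Type*} [NormedAddCommGroup H] [InnerProductSpace ℂ H]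
  {V : I → H →L[ℂ] H} {M : Submodule ℂ H}

theorem isReducing_top (V : I → H →L[ℂ] H) : IsReducing V ⊤ where
  isClosed := isClosed_univ
  invariant _ _ _ := trivial
  invariant_orthogonal i x hx := by
    rw [Submodule.top_orthogonal_eq_bot, Submodule.mem_bot] at hx ⊢
    rw [hx, map_zero]

variable [CompleteSpace H]

theorem IsReducing.adjoint_mem (hM : IsReducing V M) (i : I) {x : H} (hx : x ∈ M) :
    ((V i)†) x ∈ M := by
  have : CompleteSpace M := hM.isClosed.completeSpace_coe
  exact ContinuousLinearMap.mem_invtSubmodule_adjoint_iff.2 (hM.invariant_orthogonal i) hx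

theorem isReducing_of_adjoint_mem (hclosed : IsClosed (M : Set H))
    (hV : ∀ i, ∀ x ∈ M, V i x ∈ M) (hV' : ∀ i, ∀ x ∈ M, ((V i)†) x ∈ M) : IsReducing V M where
  isClosed := hclosed
  invariant := hV
  invariant_orthogonal i _ hx := ContinuousLinearMap.orthogonal_mem_invtSubmodule (hV' i) hx

theorem isPure_iff {J : Set I} :
    IsPure J V ↔ ∀ M, IsReducing V M → (∀ j ∈ J, ActsUnitarilyOn (V j) M) → M = ⊥ := by
  refine forall₂_congr fun M hM => ?_
  have : CompleteSpace M := hM.isClosed.completeSpace_coe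
  have hrestrict : IsUnitaryOn J hM.restrict ↔ ∀ j ∈ J, ActsUnitarilyOn (V j) M :=
    forall₂_congr fun j _ => restrict_mem_unitary_iff (hM.invariant j)
  rw [hrestrict, ne_eq, not_imp_not]

theorem isCompletelyNonunitary_iff {T : H →L[ℂ] H} (hT : ‖T‖ ≤ 1) :
    IsCompletelyNonunitary T ↔
      ∀ N : Submodule ℂ H, IsClosed (N : Set H) → ActsUnitarilyOn T N → N = ⊥ := by
  rw [IsCompletelyNonunitary, isPure_iff]
  constructor
  · intro h N hclosed hN
    exact h N (isReducing_of_adjoint_mem hclosed (fun _ _ hx => hN.mapsTo hx)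
      fun _ _ hx => hN.adjoint_mem hT hx) fun _ _ => hN
  · intro h N hred hN
    exact h N hred.isClosed (hN () trivial)

end Families

section SequenceSpaces

variable {E ι : Type*} [NormedAddCommGroup E]

theorem hasSum_norm_sq (f : lp (fun _ : ι => E) 2) :
    HasSum (fun i => ‖f i‖ ^ 2) (‖f‖ ^ 2) := by
  simpa using lp.hasSum_norm (p := 2) (by norm_num) f

theorem norm_eq_of_forall_norm_apply_eq {f g : lp (fun _ : ι => E) 2}
    (h : ∀ i, ‖f i‖ = ‖g i‖) : ‖f‖ = ‖g‖ := by
  refine (sq_eq_sq₀ (norm_nonneg _) (norm_nonneg _)).1 ((hasSum_norm_sq f).unique ?_)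
  simpa only [h] using hasSum_norm_sq g

variable [InnerProductSpace ℂ E]

@[simp] theorem unilateralShift_apply_zero (f : HardySpace E) : unilateralShift E f 0 = 0 := rfl

@[simp] theorem unilateralShift_apply_succ (f : HardySpace E) (n : ℕ) :
    unilateralShift E f (n + 1) = f n := rfl

theorem unilateralShift_single (n : ℕ) (x : E) :
    unilateralShift E (lp.single 2 n x) = lp.single 2 (n + 1) x := by
  ext k
  cases k <;> simp [Pi.single_apply]

@[simp] theorem coefficientwise_apply (T : E →L[ℂ] E) (hT : ∀ x, ‖T x‖ ≤ ‖x‖) (f : HardySpace E)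
    (n : ℕ) : coefficientwise T hT f n = T (f n) := rfl

theorem coefficientwise_single (T : E →L[ℂ] E) (hT : ∀ x, ‖T x‖ ≤ ‖x‖) (n : ℕ) (x : E) :
    coefficientwise T hT (lp.single 2 n x) = lp.single 2 n (T x) := by
  ext k
  rcases eq_or_ne k n with rfl | hkn
  · simp
  · simp [hkn]

@[simp] theorem translate_apply (m : ℤ) (f : LaurentSpace E) (n : ℤ) :
    translate E m f n = f (n - m) := rfl

theorem translate_translate (m m' : ℤ) (f : LaurentSpace E) :
    translate E m (translate E m' f) = translate E (m + m') f := by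
  ext n
  simp [sub_sub]

theorem hardyInclusion_apply (f : HardySpace E) (n : ℤ) :
    hardyInclusion E f n = if 0 ≤ n then f n.toNat else 0 := rfl

theorem hardyInclusion_unilateralShift (f : HardySpace E) :
    hardyInclusion E (unilateralShift E f) = translate E 1 (hardyInclusion E f) := by
  ext n
  rw [translate_apply, hardyInclusion_apply, hardyInclusion_apply]
  rcases lt_trichotomy n 0 with hn | rfl | hn
  · rw [if_neg (by omega), if_neg (by omega)]
  · simp
  · rw [if_pos (by omega), if_pos (by omega), show n.toNat = (n - 1).toNat + 1 by omega,
      unilateralShift_apply_succ]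

theorem norm_hardyInclusion (f : HardySpace E) : ‖hardyInclusion E f‖ = ‖f‖ := by
  refine (sq_eq_sq₀ (norm_nonneg _) (norm_nonneg _)).1 ((hasSum_norm_sq _).unique ?_)
  refine (Nat.cast_injective (R := ℤ) |>.hasSum_iff fun n hn => ?_).1 ?_
  · have hneg : ¬ 0 ≤ n := fun h => hn ⟨n.toNat, Int.toNat_of_nonneg h⟩
    simp [hardyInclusion_apply, hneg]
  · exact hasSum_norm_sq f

variable [CompleteSpace E]

theorem norm_translate (m : ℤ) (f : LaurentSpace E) : ‖translate E m f‖ = ‖f‖ := by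
  refine le_antisymm (norm_translate_apply_le m f) ?_
  simpa [translate_translate, translate_zero] using
    norm_translate_apply_le (-m) (translate E m f)

theorem adjoint_unilateralShift_apply (f : HardySpace E) (n : ℕ) :
    ((unilateralShift E)†) f n = f (n + 1) := by
  refine ext_inner_left ℂ fun x : E => ?_
  calc ⟪x, ((unilateralShift E)†) f n⟫_ℂ = ⟪unilateralShift E (lp.single 2 n x), f⟫_ℂ := by
        rw [← ContinuousLinearMap.adjoint_inner_right, lp.inner_single_left]
    _ = ⟪x, f (n + 1)⟫_ℂ := by rw [unilateralShift_single, lp.inner_single_left]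

theorem adjoint_coefficientwise_apply (T : E →L[ℂ] E) (hT : ∀ x, ‖T x‖ ≤ ‖x‖)
    (f : HardySpace E) (n : ℕ) : ((coefficientwise T hT)†) f n = (T†) (f n) := by
  refine ext_inner_left ℂ fun x : E => ?_
  calc ⟪x, ((coefficientwise T hT)†) f n⟫_ℂ = ⟪coefficientwise T hT (lp.single 2 n x), f⟫_ℂ := by
        rw [← ContinuousLinearMap.adjoint_inner_right, lp.inner_single_left]
    _ = ⟪x, (T†) (f n)⟫_ℂ := by
        rw [coefficientwise_single, lp.inner_single_left, ContinuousLinearMap.adjoint_inner_right]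

end SequenceSpaces

section Coefficients

variable {E : Type*} [NormedAddCommGroup E] [InnerProductSpace ℂ E]

theorem coeff_zero (Θ : ℂ → E →L[ℂ] E) : coeff Θ 0 = Θ 0 := by
  simp [coeff]

variable {Θ : ℂ → E →L[ℂ] E}

theorem IsContractiveAnalytic.norm_apply_zero_le_one (hΘ : IsContractiveAnalytic Θ) : ‖Θ 0‖ ≤ 1 :=
  hΘ.norm_le_one 0 (Metric.mem_ball_self one_pos)

variable [CompleteSpace E]

theorem toeplitz_apply (hΘ : IsContractiveAnalytic Θ) (f : HardySpace E) (n : ℕ) :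
    toeplitz hΘ f n = ∑ k ∈ Finset.range (n + 1), coeff Θ k (f (n - k)) := rfl

theorem laurent_apply (hΘ : IsContractiveAnalytic Θ) (f : LaurentSpace E) (n : ℤ) :
    laurent hΘ f n = ∑' k : ℕ, coeff Θ k (f (n - k)) := rfl

theorem norm_defect_sq (hΘ : IsContractiveAnalytic Θ) (f : LaurentSpace E) :
    ‖defect hΘ f‖ ^ 2 = ‖f‖ ^ 2 - ‖laurent hΘ f‖ ^ 2 :=
  norm_defectOperator_sq (fun f => norm_ofCoords_apply_le _ _ f) f

theorem norm_defect_hardyInclusion_sq (hΘ : IsContractiveAnalytic Θ) (f : HardySpace E) :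
    ‖defect hΘ (hardyInclusion E f)‖ ^ 2 = ‖f‖ ^ 2 - ‖toeplitz hΘ f‖ ^ 2 := by
  rw [norm_defect_sq, laurent_hardyInclusion, norm_hardyInclusion, norm_hardyInclusion]

theorem toeplitz_apply_zero (hΘ : IsContractiveAnalytic Θ) (f : HardySpace E) :
    toeplitz hΘ f 0 = Θ 0 (f 0) := by
  simp [toeplitz_apply, coeff_zero]

theorem toeplitz_single_zero (hΘ : IsContractiveAnalytic Θ) (x : E) (n : ℕ) :
    toeplitz hΘ (lp.single 2 0 x) n = coeff Θ n x := by
  rw [toeplitz_apply, Finset.sum_eq_single_of_mem n (Finset.self_mem_range_succ n)]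
  · simp
  · intro k hk hkn
    have hkn' : n - k ≠ 0 := by have := Finset.mem_range.1 hk; omega
    rw [lp.single_apply_ne _ _ _ hkn', map_zero]

theorem toeplitz_unilateralShift (hΘ : IsContractiveAnalytic Θ) (f : HardySpace E) :
    toeplitz hΘ (unilateralShift E f) = unilateralShift E (toeplitz hΘ f) := by
  ext n
  cases n with
  | zero => simp [toeplitz_apply]
  | succ n =>
    rw [toeplitz_apply, unilateralShift_apply_succ, toeplitz_apply, Finset.sum_range_succ,
      Nat.sub_self, unilateralShift_apply_zero, map_zero, add_zero]
    refine Finset.sum_congr rfl fun k hk => ?_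
    rw [Nat.succ_sub (Finset.mem_range_succ_iff.1 hk), unilateralShift_apply_succ]

namespace IsContractiveAnalytic

theorem coeff_apply_eq_zero (hΘ : IsContractiveAnalytic Θ) {x : E} (hx : ‖Θ 0 x‖ = ‖x‖) {k : ℕ}
    (hk : k ≠ 0) : coeff Θ k x = 0 := by
  have hle : ‖x‖ ^ 2 + ‖coeff Θ k x‖ ^ 2 ≤ ‖x‖ ^ 2 :=
    calc ‖x‖ ^ 2 + ‖coeff Θ k x‖ ^ 2
        = ∑ n ∈ {0, k}, ‖toeplitz hΘ (lp.single 2 0 x) n‖ ^ 2 := by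
          rw [Finset.sum_pair hk.symm, toeplitz_single_zero, toeplitz_single_zero, coeff_zero, hx]
      _ ≤ ‖toeplitz hΘ (lp.single 2 0 x)‖ ^ 2 := sum_norm_sq_le _ _
      _ ≤ ‖lp.single (E := fun _ : ℕ => E) 2 0 x‖ ^ 2 := by
          gcongr
          exact norm_ofCoords_apply_le _ _ _
      _ = ‖x‖ ^ 2 := by rw [lp.norm_single two_pos]
  rw [← norm_eq_zero, ← sq_eq_zero_iff]
  exact le_antisymm (by linarith) (sq_nonneg _)

theorem eq_apply_zero_of_norm_map (hΘ : IsContractiveAnalytic Θ) (h : ∀ x, ‖Θ 0 x‖ = ‖x‖) {z : ℂ}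
    (hz : z ∈ Metric.ball (0 : ℂ) 1) : Θ z = Θ 0 := by
  have hcoeff (k : ℕ) (hk : k ≠ 0) : z ^ k • coeff Θ k = 0 := by
    rw [show coeff Θ k = 0 from ContinuousLinearMap.ext fun x => hΘ.coeff_apply_eq_zero (h x) hk,
      smul_zero]
  refine (hΘ.hasSum_coeff (mem_ball_zero_iff.1 hz)).unique ?_
  simpa [coeff_zero] using hasSum_single 0 hcoeff

end IsContractiveAnalytic

theorem toeplitz_apply_of_norm_eq (hΘ : IsContractiveAnalytic Θ) {f : HardySpace E}
    (hf : ∀ n, ‖Θ 0 (f n)‖ = ‖f n‖) (n : ℕ) : toeplitz hΘ f n = Θ 0 (f n) := by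
  rw [toeplitz_apply, Finset.sum_eq_single_of_mem 0 (Finset.mem_range.2 n.succ_pos)
    fun k _ hk => hΘ.coeff_apply_eq_zero (hf _) hk, coeff_zero, Nat.sub_zero]

theorem laurent_apply_of_norm_eq (hΘ : IsContractiveAnalytic Θ) {f : LaurentSpace E}
    (hf : ∀ n, ‖Θ 0 (f n)‖ = ‖f n‖) (n : ℤ) : laurent hΘ f n = Θ 0 (f n) := by
  rw [laurent_apply, tsum_eq_single 0 fun k hk => hΘ.coeff_apply_eq_zero (hf _) hk, coeff_zero,
    Nat.cast_zero, sub_zero]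

theorem defect_eq_zero_of_norm_eq (hΘ : IsContractiveAnalytic Θ) {f : LaurentSpace E}
    (hf : ∀ n, ‖Θ 0 (f n)‖ = ‖f n‖) : defect hΘ f = 0 := by
  have hnorm : ‖laurent hΘ f‖ = ‖f‖ :=
    norm_eq_of_forall_norm_apply_eq fun n => by rw [laurent_apply_of_norm_eq hΘ hf, hf]
  rw [← norm_eq_zero, ← sq_eq_zero_iff, norm_defect_sq, hnorm, sub_self]

theorem defect_hardyInclusion_eq_zero_of_norm_eq (hΘ : IsContractiveAnalytic Θ)
    {f : HardySpace E} (hf : ∀ n, ‖Θ 0 (f n)‖ = ‖f n‖) : defect hΘ (hardyInclusion E f) = 0 := by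
  refine defect_eq_zero_of_norm_eq hΘ fun n => ?_
  rw [hardyInclusion_apply]
  split_ifs
  · exact hf _
  · simp

theorem defectSpace_eq_bot_of_norm_map (hΘ : IsContractiveAnalytic Θ)
    (h : ∀ x, ‖Θ 0 x‖ = ‖x‖) : defectSpace hΘ = ⊥ := by
  have hdefect : defect hΘ = 0 :=
    ContinuousLinearMap.ext fun f => defect_eq_zero_of_norm_eq hΘ fun n => h (f n)
  rw [defectSpace, hdefect, ContinuousLinearMap.toLinearMap_zero, LinearMap.range_zero]
  exact isClosed_singleton.submodule_topologicalClosure_eq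

end Coefficients

section Model

variable {E : Type*} [NormedAddCommGroup E] [InnerProductSpace ℂ E] [CompleteSpace E]
  {Θ : ℂ → E →L[ℂ] E} (hΘ : IsContractiveAnalytic Θ)

theorem translate_mem_defectSpace (m : ℤ) {f : LaurentSpace E} (hf : f ∈ defectSpace hΘ) :
    translate E m f ∈ defectSpace hΘ := by
  refine map_mem_closure (translate E m).continuous hf ?_
  rintro _ ⟨g, rfl⟩
  exact ⟨translate E m g, congrArg (fun T => T g) (defect_commute_translate hΘ m).eq⟩

theorem defectShift_mem_unitary :
    defectShift hΘ ∈ unitary (defectSpace hΘ →L[ℂ] defectSpace hΘ) := by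
  refine (restrict_mem_unitary_iff fun _ hf => bilateralShift_mem hΘ hf).2
    ⟨fun _ hf => bilateralShift_mem hΘ hf, fun f hf => ?_, fun f _ => norm_translate 1 f⟩
  refine ⟨translate E (-1) f, translate_mem_defectSpace hΘ (-1) hf, ?_⟩
  rw [bilateralShift, translate_translate, add_neg_cancel, translate_zero, one_apply_eq_self]

@[simp] theorem modelW₀_fst (p : ModelSpace hΘ) :
    (modelW₀ hΘ p).fst = unilateralShift E p.fst := rfl

@[simp] theorem modelW₀_snd (p : ModelSpace hΘ) (n : ℕ) :
    (modelW₀ hΘ p).snd n = defectShift hΘ (p.snd n) := rfl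

@[simp] theorem modelW₁_fst (p : ModelSpace hΘ) :
    (modelW₁ hΘ p).fst = toeplitz hΘ p.fst := rfl

theorem modelW₁_snd (p : ModelSpace hΘ) :
    (modelW₁ hΘ p).snd =
      lp.single 2 0 ⟨defect hΘ (hardyInclusion E p.fst), defect_mem hΘ _⟩ +
        unilateralShift (defectSpace hΘ) p.snd := rfl

theorem coe_modelW₁_snd_zero (p : ModelSpace hΘ) :
    ((modelW₁ hΘ p).snd 0 : LaurentSpace E) = defect hΘ (hardyInclusion E p.fst) := by
  simp [modelW₁_snd]

@[simp] theorem modelW₁_snd_succ (p : ModelSpace hΘ) (n : ℕ) :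
    (modelW₁ hΘ p).snd (n + 1) = p.snd n := by
  simp [modelW₁_snd]

theorem modelSpace_ext {p q : ModelSpace hΘ} (hfst : ∀ n, p.fst n = q.fst n)
    (hsnd : ∀ n, p.snd n = q.snd n) : p = q :=
  WithLp.ofLp_injective _ (Prod.ext (lp.ext (funext hfst)) (lp.ext (funext hsnd)))

theorem norm_modelW₁ (p : ModelSpace hΘ) : ‖modelW₁ hΘ p‖ = ‖p‖ := by
  have hsnd : ‖(modelW₁ hΘ p).snd‖ ^ 2 =
      ‖p.fst‖ ^ 2 - ‖toeplitz hΘ p.fst‖ ^ 2 + ‖p.snd‖ ^ 2 := by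
    refine (hasSum_norm_sq _).unique ((hasSum_nat_add_iff' 1).1 ?_)
    rw [Finset.sum_range_one, Submodule.coe_norm, coe_modelW₁_snd_zero,
      norm_defect_hardyInclusion_sq, add_sub_cancel_left]
    simpa only [modelW₁_snd_succ] using hasSum_norm_sq p.snd
  rw [WithLp.prod_norm_eq_of_L2, WithLp.prod_norm_eq_of_L2, hsnd, modelW₁_fst]
  congr 1
  ring

theorem opNorm_modelW₁_le_one : ‖modelW₁ hΘ‖ ≤ 1 :=
  ContinuousLinearMap.opNorm_le_bound _ zero_le_one fun p => by rw [norm_modelW₁, one_mul]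

theorem modelW₀_commute_modelW₁ : Commute (modelW₀ hΘ) (modelW₁ hΘ) := by
  refine ContinuousLinearMap.ext fun p => modelSpace_ext hΘ (fun n => ?_) fun n => ?_
  · exact congrArg (fun f : HardySpace E => f n) (toeplitz_unilateralShift hΘ p.fst).symm
  · change (modelW₀ hΘ (modelW₁ hΘ p)).snd n = (modelW₁ hΘ (modelW₀ hΘ p)).snd n
    cases n with
    | zero =>
      apply Subtype.ext
      rw [coe_modelW₁_snd_zero, modelW₀_fst, hardyInclusion_unilateralShift, modelW₀_snd]
      change translate E 1 ((modelW₁ hΘ p).snd 0 : LaurentSpace E) = _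
      rw [coe_modelW₁_snd_zero]
      exact congrArg (fun T => T (hardyInclusion E p.fst)) (defect_commute_translate hΘ 1).eq.symm
    | succ n => rw [modelW₀_snd, modelW₁_snd_succ, modelW₁_snd_succ, modelW₀_snd]

theorem adjoint_modelW₀_apply (p : ModelSpace hΘ) :
    ((modelW₀ hΘ)†) p = WithLp.toLp 2 (((unilateralShift E)†) p.fst,
      ((coefficientwise (defectShift hΘ)
        fun g => norm_translate_apply_le 1 (g : LaurentSpace E))†) p.snd) := by
  refine ext_inner_left ℂ fun q => ?_
  rw [ContinuousLinearMap.adjoint_inner_right, WithLp.prod_inner_apply, WithLp.prod_inner_apply,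
    ContinuousLinearMap.adjoint_inner_right, ContinuousLinearMap.adjoint_inner_right]
  rfl

theorem adjoint_modelW₀_fst (p : ModelSpace hΘ) (n : ℕ) :
    (((modelW₀ hΘ)†) p).fst n = p.fst (n + 1) := by
  rw [adjoint_modelW₀_apply]
  exact adjoint_unilateralShift_apply p.fst n

theorem adjoint_modelW₀_snd (p : ModelSpace hΘ) (n : ℕ) :
    (((modelW₀ hΘ)†) p).snd n = ((defectShift hΘ)†) (p.snd n) := by
  rw [adjoint_modelW₀_apply]
  exact adjoint_coefficientwise_apply _ _ p.snd n

/-- The inclusion of `E` into the model space as the constant functions in `H²(E) ⊕ 0`. -/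
noncomputable def modelConst : E →L[ℂ] ModelSpace hΘ :=
  let e := WithLp.prodContinuousLinearEquiv 2 ℂ (HardySpace E) (HardySpace (defectSpace hΘ))
  e.symm ∘L ContinuousLinearMap.inl ℂ (HardySpace E) (HardySpace (defectSpace hΘ)) ∘L
    lp.singleContinuousLinearMap ℂ (fun _ : ℕ => E) 2 0

@[simp] theorem modelConst_fst (x : E) : (modelConst hΘ x).fst = lp.single 2 0 x := rfl

@[simp] theorem modelConst_snd (x : E) : (modelConst hΘ x).snd = 0 := rfl

theorem norm_modelConst (x : E) : ‖modelConst hΘ x‖ = ‖x‖ := by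
  rw [WithLp.prod_norm_eq_of_L2, modelConst_fst, modelConst_snd, lp.norm_single two_pos]
  simp

theorem modelConst_fst_zero (p : ModelSpace hΘ) :
    modelConst hΘ (p.fst 0) = p - modelW₀ hΘ (((modelW₀ hΘ)†) p) := by
  refine modelSpace_ext hΘ (fun n => ?_) fun n => ?_
  · cases n with
    | zero => simp
    | succ n => simp [adjoint_modelW₀_fst]
  · have hunitary : defectShift hΘ (((defectShift hΘ)†) (p.snd n)) = p.snd n :=
      congrArg (fun T => T (p.snd n))
        (Unitary.mul_star_self_of_mem (defectShift_mem_unitary hΘ))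
    simp [adjoint_modelW₀_snd, hunitary]

end Model

section ReducingSubspaces

variable {E : Type*} [NormedAddCommGroup E] [InnerProductSpace ℂ E] [CompleteSpace E]
  {Θ : ℂ → E →L[ℂ] E} {hΘ : IsContractiveAnalytic Θ}

section OfModel

variable {M : Submodule ℂ (ModelSpace hΘ)}

theorem IsReducing.adjoint_modelW₀_mem (hM : IsReducing (model hΘ) M) {p : ModelSpace hΘ}
    (hp : p ∈ M) : ((modelW₀ hΘ)†) p ∈ M :=
  hM.adjoint_mem 0 hp

theorem IsReducing.modelConst_fst_mem (hM : IsReducing (model hΘ) M) {p : ModelSpace hΘ}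
    (hp : p ∈ M) (n : ℕ) : modelConst hΘ (p.fst n) ∈ M := by
  induction n generalizing p with
  | zero =>
    rw [modelConst_fst_zero]
    exact M.sub_mem hp (hM.invariant 0 _ (hM.adjoint_modelW₀_mem hp))
  | succ n ih =>
    rw [← adjoint_modelW₀_fst]
    exact ih (hM.adjoint_modelW₀_mem hp)

theorem adjoint_modelW₀_modelW₁ (hM : IsReducing (model hΘ) M)
    (hU : ActsUnitarilyOn (modelW₁ hΘ) M) {p : ModelSpace hΘ} (hp : p ∈ M) :
    ((modelW₀ hΘ)†) (modelW₁ hΘ p) = modelW₁ hΘ (((modelW₀ hΘ)†) p) :=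
  hU.adjoint_apply_apply_comm (opNorm_modelW₁_le_one hΘ) (modelW₀_commute_modelW₁ hΘ)
    (fun _ => hM.adjoint_modelW₀_mem) hp

theorem modelW₁_fst_apply_of_mem (hM : IsReducing (model hΘ) M)
    (hU : ActsUnitarilyOn (modelW₁ hΘ) M) {p : ModelSpace hΘ} (hp : p ∈ M) (n : ℕ) :
    (modelW₁ hΘ p).fst n = Θ 0 (p.fst n) := by
  induction n generalizing p with
  | zero => exact toeplitz_apply_zero hΘ p.fst
  | succ n ih =>
    rw [← adjoint_modelW₀_fst, adjoint_modelW₀_modelW₁ hM hU hp,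
      ih (hM.adjoint_modelW₀_mem hp), adjoint_modelW₀_fst]

theorem modelW₁_modelConst_fst_zero (hM : IsReducing (model hΘ) M)
    (hU : ActsUnitarilyOn (modelW₁ hΘ) M) {p : ModelSpace hΘ} (hp : p ∈ M) :
    modelW₁ hΘ (modelConst hΘ (p.fst 0)) = modelConst hΘ (Θ 0 (p.fst 0)) := by
  have hcomm (q : ModelSpace hΘ) : modelW₁ hΘ (modelW₀ hΘ q) = modelW₀ hΘ (modelW₁ hΘ q) :=
    congrArg (fun T => T q) (modelW₀_commute_modelW₁ hΘ).eq.symm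
  rw [← modelW₁_fst_apply_of_mem hM hU hp, modelConst_fst_zero, modelConst_fst_zero, map_sub,
    hcomm, adjoint_modelW₀_modelW₁ hM hU hp]

theorem actsUnitarilyOn_comap_modelConst (hM : IsReducing (model hΘ) M)
    (hU : ActsUnitarilyOn (modelW₁ hΘ) M) :
    ActsUnitarilyOn (Θ 0) (M.comap (modelConst hΘ : E →ₗ[ℂ] ModelSpace hΘ)) := by
  have hconst {x : E} (hx : modelConst hΘ x ∈ M) :
      modelW₁ hΘ (modelConst hΘ x) = modelConst hΘ (Θ 0 x) := by
    simpa using modelW₁_modelConst_fst_zero hM hU hx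
  refine ⟨fun x hx => ?_, fun y hy => ?_, fun x hx => ?_⟩
  · change modelConst hΘ (Θ 0 x) ∈ M
    rw [← hconst hx]
    exact hU.mapsTo hx
  · obtain ⟨q, hq, hqy⟩ := hU.surjOn hy
    refine ⟨q.fst 0, hM.modelConst_fst_mem hq 0, ?_⟩
    rw [← modelW₁_fst_apply_of_mem hM hU hq, hqy]
    simp
  · have hx' : modelConst hΘ x ∈ M := hx
    rw [← norm_modelConst hΘ, ← hconst hx', hU.norm_map _ hx', norm_modelConst]

theorem snd_apply_eq_zero_of_mem (hM : IsReducing (model hΘ) M)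
    (hU : ActsUnitarilyOn (modelW₁ hΘ) M) {p : ModelSpace hΘ} (hp : p ∈ M) (n : ℕ) :
    p.snd n = 0 := by
  obtain ⟨q, hq, rfl⟩ := hU.surjOn hp
  induction n generalizing q with
  | zero =>
    have hdefect : defect hΘ (hardyInclusion E q.fst) = 0 :=
      defect_hardyInclusion_eq_zero_of_norm_eq hΘ fun n =>
        (actsUnitarilyOn_comap_modelConst hM hU).norm_map _ (hM.modelConst_fst_mem hq n)
    exact Subtype.ext ((coe_modelW₁_snd_zero hΘ q).trans hdefect)
  | succ n ih =>
    obtain ⟨r, hr, rfl⟩ := hU.surjOn hq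
    rw [modelW₁_snd_succ]
    exact ih r hr hq

end OfModel

section OfConstants

variable {N : Submodule ℂ E}

/-- The subspace `H²(N) ⊕ 0` of the model space. -/
def hardySubspace (hΘ : IsContractiveAnalytic Θ) (N : Submodule ℂ E) :
    Submodule ℂ (ModelSpace hΘ) where
  carrier := {p | (∀ n, p.fst n ∈ N) ∧ ∀ n, p.snd n = 0}
  add_mem' hp hq := ⟨fun n => N.add_mem (hp.1 n) (hq.1 n), fun n => by simp [hp.2 n, hq.2 n]⟩
  zero_mem' := ⟨fun _ => N.zero_mem, fun _ => rfl⟩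
  smul_mem' c _ hp := ⟨fun n => N.smul_mem c (hp.1 n), fun n => by simp [hp.2 n]⟩

theorem mem_hardySubspace {p : ModelSpace hΘ} :
    p ∈ hardySubspace hΘ N ↔ (∀ n, p.fst n ∈ N) ∧ ∀ n, p.snd n = 0 := Iff.rfl

theorem hardySubspace_bot : hardySubspace hΘ (⊥ : Submodule ℂ E) = ⊥ :=
  (Submodule.eq_bot_iff _).2 fun _ hp => modelSpace_ext hΘ hp.1 hp.2

theorem hardySubspace_top (h : ∀ x, ‖Θ 0 x‖ = ‖x‖) :
    hardySubspace hΘ (⊤ : Submodule ℂ E) = ⊤ := by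
  refine (Submodule.eq_top_iff').2 fun p => ⟨fun _ => trivial, fun n => Subtype.ext ?_⟩
  exact (Submodule.mem_bot ℂ).1 ((defectSpace_eq_bot_of_norm_map hΘ h).le (p.snd n).2)

theorem modelConst_mem_hardySubspace {x : E} (hx : x ∈ N) :
    modelConst hΘ x ∈ hardySubspace hΘ N := by
  refine ⟨fun n => ?_, fun _ => rfl⟩
  rw [modelConst_fst, lp.single_apply, Pi.single_apply]
  split_ifs
  exacts [hx, N.zero_mem]

theorem isClosed_hardySubspace (hN : IsClosed (N : Set E)) :
    IsClosed (hardySubspace hΘ N : Set (ModelSpace hΘ)) := by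
  have hfst (n : ℕ) : Continuous fun p : ModelSpace hΘ => p.fst n :=
    (lp.evalCLM ℂ (fun _ : ℕ => E) 2 n).continuous.comp (WithLp.prod_continuous_ofLp 2 _ _).fst
  have hsnd (n : ℕ) : Continuous fun p : ModelSpace hΘ => p.snd n :=
    (lp.evalCLM ℂ (fun _ : ℕ => defectSpace hΘ) 2 n).continuous.comp
      (WithLp.prod_continuous_ofLp 2 _ _).snd
  have hset : (hardySubspace hΘ N : Set (ModelSpace hΘ)) =
      (⋂ n, (fun p : ModelSpace hΘ => p.fst n) ⁻¹' N) ∩ ⋂ n, (fun p => p.snd n) ⁻¹' {0} := by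
    ext p
    simp [mem_hardySubspace]
  rw [hset]
  exact (isClosed_iInter fun n => hN.preimage (hfst n)).inter
    (isClosed_iInter fun n => isClosed_singleton.preimage (hsnd n))

theorem modelW₁_fst_apply_of_mem_hardySubspace (hN : ActsUnitarilyOn (Θ 0) N)
    {p : ModelSpace hΘ} (hp : p ∈ hardySubspace hΘ N) (n : ℕ) :
    (modelW₁ hΘ p).fst n = Θ 0 (p.fst n) :=
  toeplitz_apply_of_norm_eq hΘ (fun n => hN.norm_map _ (hp.1 n)) n

theorem modelW₁_snd_apply_of_mem_hardySubspace (hN : ActsUnitarilyOn (Θ 0) N)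
    {p : ModelSpace hΘ} (hp : p ∈ hardySubspace hΘ N) (n : ℕ) :
    (modelW₁ hΘ p).snd n = 0 := by
  cases n with
  | zero =>
    exact Subtype.ext ((coe_modelW₁_snd_zero hΘ p).trans
      (defect_hardyInclusion_eq_zero_of_norm_eq hΘ fun n => hN.norm_map _ (hp.1 n)))
  | succ n => rw [modelW₁_snd_succ, hp.2 n]

theorem actsUnitarilyOn_modelW₁_hardySubspace (hN : ActsUnitarilyOn (Θ 0) N) :
    ActsUnitarilyOn (modelW₁ hΘ) (hardySubspace hΘ N) := by
  refine ⟨fun p hp => ⟨fun n => ?_, modelW₁_snd_apply_of_mem_hardySubspace hN hp⟩,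
    fun q hq => ?_, fun p _ => norm_modelW₁ hΘ p⟩
  · rw [modelW₁_fst_apply_of_mem_hardySubspace hN hp]
    exact hN.mapsTo (hp.1 n)
  · have hΘ₀ := hΘ.norm_apply_zero_le_one
    let p : ModelSpace hΘ :=
      WithLp.toLp 2 (coefficientwise ((Θ 0)†) (norm_adjoint_apply_le hΘ₀) q.fst, 0)
    have hp : p ∈ hardySubspace hΘ N :=
      ⟨fun n => hN.adjoint_mem hΘ₀ (hq.1 n), fun _ => rfl⟩
    refine ⟨p, hp, modelSpace_ext hΘ (fun n => ?_) fun n => ?_⟩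
    · rw [modelW₁_fst_apply_of_mem_hardySubspace hN hp]
      exact hN.apply_adjoint_apply hΘ₀ (hq.1 n)
    · rw [modelW₁_snd_apply_of_mem_hardySubspace hN hp, hq.2]

theorem isReducing_hardySubspace (hN : ActsUnitarilyOn (Θ 0) N)
    (hclosed : IsClosed (N : Set E)) :
    IsReducing (model hΘ) (hardySubspace hΘ N) := by
  have hU := actsUnitarilyOn_modelW₁_hardySubspace (hΘ := hΘ) hN
  refine isReducing_of_adjoint_mem (isClosed_hardySubspace hclosed) ?_ ?_ <;>
    refine Fin.forall_fin_two.2 ⟨fun p hp => ?_, fun p hp => ?_⟩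
  · refine ⟨fun n => ?_, fun n => ?_⟩
    · cases n with
      | zero => exact N.zero_mem
      | succ n => exact hp.1 n
    · exact (congrArg (defectShift hΘ) (hp.2 n)).trans (map_zero _)
  · exact hU.mapsTo hp
  · refine ⟨fun n => ?_, fun n => ?_⟩
    · change (((modelW₀ hΘ)†) p).fst n ∈ N
      rw [adjoint_modelW₀_fst]
      exact hp.1 (n + 1)
    · exact (adjoint_modelW₀_snd hΘ p n).trans ((congrArg _ (hp.2 n)).trans (map_zero _))
  · exact hU.adjoint_mem (opNorm_modelW₁_le_one hΘ) hp

end OfConstants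

variable (hΘ)

theorem modelW₁_mem_unitary_iff :
    modelW₁ hΘ ∈ unitary (ModelSpace hΘ →L[ℂ] ModelSpace hΘ) ↔
      (∀ z ∈ Metric.ball (0 : ℂ) 1, Θ z = Θ 0) ∧ Θ 0 ∈ unitary (E →L[ℂ] E) := by
  rw [mem_unitary_iff_actsUnitarilyOn_top, mem_unitary_iff_actsUnitarilyOn_top]
  constructor
  · intro hU
    have hΘ₀ : ActsUnitarilyOn (Θ 0) ⊤ :=
      actsUnitarilyOn_comap_modelConst (isReducing_top _) hU
    exact ⟨fun z hz => hΘ.eq_apply_zero_of_norm_map (fun x => hΘ₀.norm_map x trivial) hz, hΘ₀⟩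
  · rintro ⟨-, hΘ₀⟩
    rw [← hardySubspace_top fun x => hΘ₀.norm_map x trivial]
    exact actsUnitarilyOn_modelW₁_hardySubspace hΘ₀

theorem isPure_model_iff : IsPure {1} (model hΘ) ↔ IsCompletelyNonunitary (Θ 0) := by
  rw [isPure_iff, isCompletelyNonunitary_iff hΘ.norm_apply_zero_le_one]
  constructor
  · intro hpure N hclosed hN
    have hbot : hardySubspace hΘ N = ⊥ :=
      hpure _ (isReducing_hardySubspace hN hclosed) fun j hj =>
        hj ▸ actsUnitarilyOn_modelW₁_hardySubspace hN
    refine (Submodule.eq_bot_iff N).2 fun x hx => norm_eq_zero.1 ?_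
    have hx' : modelConst hΘ x = 0 :=
      (Submodule.mem_bot ℂ).1 (hbot ▸ modelConst_mem_hardySubspace hx)
    rw [← norm_modelConst hΘ, hx', norm_zero]
  · intro hcnu M hM hU
    have hU₁ : ActsUnitarilyOn (modelW₁ hΘ) M := hU 1 rfl
    have hbot := hcnu _ (hM.isClosed.preimage (modelConst hΘ).continuous)
      (actsUnitarilyOn_comap_modelConst hM hU₁)
    rw [← le_bot_iff, ← hardySubspace_bot, ← hbot]
    exact fun p hp => ⟨hM.modelConst_fst_mem hp, snd_apply_eq_zero_of_mem hM hU₁ hp⟩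

end ReducingSubspaces

end BiIsometry

theorem proposition5p3 {E : Type*} [NormedAddCommGroup E] [InnerProductSpace ℂ E]
    [CompleteSpace E] (Θ : ℂ → E →L[ℂ] E) (hΘ : BiIsometry.IsContractiveAnalytic Θ) :
    (BiIsometry.model hΘ 1 ∈ unitary (BiIsometry.ModelSpace hΘ →L[ℂ] BiIsometry.ModelSpace hΘ) ↔
      (∀ z ∈ Metric.ball (0 : ℂ) 1, Θ z = Θ 0) ∧ Θ 0 ∈ unitary (E →L[ℂ] E)) ∧
    (BiIsometry.IsPure {1} (BiIsometry.model hΘ) ↔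
      BiIsometry.IsCompletelyNonunitary (Θ 0)) :=
  ⟨BiIsometry.modelW₁_mem_unitary_iff hΘ, BiIsometry.isPure_model_iff hΘ⟩
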